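/- Let $(M^n,g)$ be a connected smooth Riemannian manifold of dimension $n\ge 3$ with Ricci tensor $\mathrm{Ric}$, and let $f,\lambda,\nu:M\to\mathbb{R}$ be smooth functions such that $(M^n,g,f,\lambda,\nu)$ is a (gradient) generalized quasi-Einstein manifold, that is, $$\mathrm{Ric}+\nabla^2 f-\nu\,df\otimes df=\lambda g,$$ where $\nabla^2 f$ denotes the Hessian of $f$. Then $$d\|\nabla f\|^2\wedge d\nu\wedge df=0\quad\text{on } M.$$ -/

import Mathlib

open scoped Manifold ContDiff Matrix

noncomputable section

namespace QuasiEinstein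

/-! ### Local Riemannian geometry in coordinates

Here `G` is the matrix-valued function `y ↦ (g_ij(y))` of a metric in coordinates on an open part of
`ℝⁿ`. Indices run over `Fin n`. -/

section Coordinates

variable {n : ℕ}

/-- The partial derivative `∂_i u` at `y`. -/
def pd (i : Fin n) (u : EuclideanSpace ℝ (Fin n) → ℝ) (y : EuclideanSpace ℝ (Fin n)) : ℝ :=
  fderiv ℝ u y (EuclideanSpace.single i 1)

/-- The Christoffel symbol of the Levi-Civita connection
`Γ^k_ij = ½ ∑_l g^{kl} (∂_i g_jl + ∂_j g_il - ∂_l g_ij)`, written `christoffel G k i j`. -/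
def christoffel (G : EuclideanSpace ℝ (Fin n) → Matrix (Fin n) (Fin n) ℝ) (k i j : Fin n)
    (y : EuclideanSpace ℝ (Fin n)) : ℝ :=
  (1 / 2) * ∑ l, (G y)⁻¹ k l *
    (pd i (fun z ↦ G z j l) y + pd j (fun z ↦ G z i l) y - pd l (fun z ↦ G z i j) y)

/-- The component `R^l_{ijk}` of the curvature tensor, where
`R(∂_i, ∂_j) ∂_k = ∇_i ∇_j ∂_k - ∇_j ∇_i ∂_k = ∑_l R^l_{ijk} ∂_l`; that is,
`R^l_{ijk} = ∂_i Γ^l_jk - ∂_j Γ^l_ik + ∑_m (Γ^l_im Γ^m_jk - Γ^l_jm Γ^m_ik)`. -/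
def riemann (G : EuclideanSpace ℝ (Fin n) → Matrix (Fin n) (Fin n) ℝ) (l i j k : Fin n)
    (y : EuclideanSpace ℝ (Fin n)) : ℝ :=
  pd i (christoffel G l j k) y - pd j (christoffel G l i k) y +
    ∑ m, (christoffel G l i m y * christoffel G m j k y -
      christoffel G l j m y * christoffel G m i k y)

/-- The component `Ric(∂_j, ∂_k) = ∑_i R^i_{ijk}` of the Ricci tensor, the trace of
`X ↦ R(X, ∂_j) ∂_k` (positive on round spheres). -/
def ricci (G : EuclideanSpace ℝ (Fin n) → Matrix (Fin n) (Fin n) ℝ) (j k : Fin n)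
    (y : EuclideanSpace ℝ (Fin n)) : ℝ :=
  ∑ i, riemann G i i j k y

/-- The component `(∇²u)(∂_i, ∂_j) = ∂_i ∂_j u - ∑_k Γ^k_ij ∂_k u` of the Hessian of `u`. -/
def hessian (G : EuclideanSpace ℝ (Fin n) → Matrix (Fin n) (Fin n) ℝ)
    (u : EuclideanSpace ℝ (Fin n) → ℝ) (i j : Fin n) (y : EuclideanSpace ℝ (Fin n)) : ℝ :=
  pd i (pd j u) y - ∑ k, christoffel G k i j y * pd k u y

end Coordinates

section Manifold

variable {n : ℕ} {M : Type*} [TopologicalSpace M] [ChartedSpace (EuclideanSpace ℝ (Fin n)) M]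
  [IsManifold (𝓡 n) ∞ M]

/-- The coordinate vector field `∂_i` of the chart `e`, at the point with coordinates `y`. -/
def coordVec (e : OpenPartialHomeomorph M (EuclideanSpace ℝ (Fin n))) (i : Fin n)
    (y : EuclideanSpace ℝ (Fin n)) : TangentSpace (𝓡 n) (e.symm y) :=
  mfderiv (𝓡 n) (𝓡 n) e.symm y (EuclideanSpace.single i (1 : ℝ) : EuclideanSpace ℝ (Fin n))

/-- The components `g_ij = g(∂_i, ∂_j)` of the metric in the chart `e`, as a function of the
coordinates. -/
def metricMatrix
    (g : Bundle.ContMDiffRiemannianMetric (𝓡 n) ∞ (EuclideanSpace ℝ (Fin n))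
      (fun x : M ↦ TangentSpace (𝓡 n) x))
    (e : OpenPartialHomeomorph M (EuclideanSpace ℝ (Fin n))) (y : EuclideanSpace ℝ (Fin n)) :
    Matrix (Fin n) (Fin n) ℝ :=
  Matrix.of fun i j ↦ g.inner (e.symm y) (coordVec e i y) (coordVec e j y)

/-- The structure of a gradient generalized quasi-Einstein manifold: `f`, `lam`, `ν` are smooth
and `Ric + ∇²f - ν df ⊗ df = lam g`, an identity between `(0,2)`-tensor fields, expressed through
their components in every chart `e` of the atlas (at all points of its domain). -/
structure IsGeneralizedQuasiEinstein
    (g : Bundle.ContMDiffRiemannianMetric (𝓡 n) ∞ (EuclideanSpace ℝ (Fin n))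
      (fun x : M ↦ TangentSpace (𝓡 n) x))
    (f lam ν : M → ℝ) : Prop where
  smooth_f : ContMDiff (𝓡 n) 𝓘(ℝ) ∞ f
  smooth_lam : ContMDiff (𝓡 n) 𝓘(ℝ) ∞ lam
  smooth_ν : ContMDiff (𝓡 n) 𝓘(ℝ) ∞ ν
  equation : ∀ e ∈ atlas (EuclideanSpace ℝ (Fin n)) M, ∀ y ∈ e.target, ∀ i j : Fin n,
    ricci (metricMatrix g e) i j y + hessian (metricMatrix g e) (f ∘ e.symm) i j y
      - ν (e.symm y) * (pd i (f ∘ e.symm) y * pd j (f ∘ e.symm) y)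
      = lam (e.symm y) * metricMatrix g e y i j

/-- The differential `df` at `p` is represented by a (necessarily unique) tangent vector. -/
theorem exists_gradient
    (g : Bundle.ContMDiffRiemannianMetric (𝓡 n) ∞ (EuclideanSpace ℝ (Fin n))
      (fun x : M ↦ TangentSpace (𝓡 n) x))
    (f : M → ℝ) (p : M) :
    ∃ w : TangentSpace (𝓡 n) p, ∀ v : TangentSpace (𝓡 n) p,
      g.inner p w v = mvfderiv (𝓡 n) f p v := by
  have : FiniteDimensional ℝ (TangentSpace (𝓡 n) p) :=
    inferInstanceAs (FiniteDimensional ℝ (EuclideanSpace ℝ (Fin n)))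
  let L : TangentSpace (𝓡 n) p →ₗ[ℝ] Module.Dual ℝ (TangentSpace (𝓡 n) p) :=
    (ContinuousLinearMap.coeLM ℝ) ∘ₗ (g.inner p).toLinearMap
  have hL : ∀ w v, L w v = g.inner p w v := fun _ _ ↦ rfl
  have hinj : Function.Injective L := by
    rw [injective_iff_map_eq_zero]
    intro w hw
    by_contra hne
    have h := g.pos p w hne
    rw [← hL, hw] at h
    simp at h
  have hsurj : Function.Surjective L :=
    (LinearMap.injective_iff_surjective_of_finrank_eq_finrank
      (Subspace.dual_finrank_eq (K := ℝ)).symm).1 hinj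
  obtain ⟨w, hw⟩ := hsurj (mvfderiv (𝓡 n) f p).toLinearMap
  exact ⟨w, fun v ↦ by rw [← hL, hw]; rfl⟩

/-- The gradient `∇f` at `p`: the tangent vector with `g(∇f, v) = df(v)` for all `v`. -/
def gradient
    (g : Bundle.ContMDiffRiemannianMetric (𝓡 n) ∞ (EuclideanSpace ℝ (Fin n))
      (fun x : M ↦ TangentSpace (𝓡 n) x))
    (f : M → ℝ) (p : M) : TangentSpace (𝓡 n) p :=
  Classical.choose (exists_gradient g f p)

/-- The function `‖∇f‖²` on `M`. -/
def gradNormSq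
    (g : Bundle.ContMDiffRiemannianMetric (𝓡 n) ∞ (EuclideanSpace ℝ (Fin n))
      (fun x : M ↦ TangentSpace (𝓡 n) x))
    (f : M → ℝ) (p : M) : ℝ :=
  g.inner p (gradient g f p) (gradient g f p)

end Manifold

/-- The wedge product `α ∧ β ∧ γ` of three linear forms, as an alternating 3-form:
`(α ∧ β ∧ γ)(v₀, v₁, v₂)` is the determinant of the matrix with rows
`(α(vᵢ), β(vᵢ), γ(vᵢ))`. -/
def wedge₃ {V : Type*} [AddCommGroup V] [Module ℝ V] (α β γ : V →ₗ[ℝ] ℝ) : V [⋀^Fin 3]→ₗ[ℝ] ℝ :=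
  (Matrix.detRowAlternating (R := ℝ) (n := Fin 3)).compLinearMap (LinearMap.pi ![α, β, γ])

end QuasiEinstein

end

/-!
The proof takes the divergence of the equation `Ric + ∇²f - ν df ⊗ df = lam g`. Write `S = ‖∇f‖²` and
`R` for the scalar curvature. There are three ingredients: the contracted Bianchi identity
`div Ric = ½ dR`, the contracted Ricci identity `div ∇²f = dΔf + Ric(∇f)`, and
`div (ν df ⊗ df) = (⟨∇ν, ∇f⟩ + ν Δf) df + ½ ν dS`. The equation evaluated on `∇f` expresses `Ric(∇f)`
through `dS` and `df`, and its trace `R + Δf - ν S = n lam` eliminates `dΔf`. What remains is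
`dR = 2 (n - 1) dlam + 2 S dν + (ν - 1) dS + B df` for some function `B`
(`IsLeviCivita.derivation_scalar`). Its exterior derivative is `0 = dS ∧ dν + dB ∧ df`, and the wedge
product with `df` gives the claim (`IsLeviCivita.wedge_eq_zero`).

The identities are local, and in a chart they use only the Leibniz rule and the symmetry of second
derivatives. They are therefore proved over a commutative ring `A` with commuting derivations `D i`,
for a connection with matrices `Γ i` and an inverse metric `h` over `A`. All tensors that are
differentiated have type `(1,1)`, with an index raised by `h`, so that the formulas for their
divergence do not involve derivatives of the metric. The ring is then specialized to the smooth
functions on the image of a chart, with the partial derivatives as derivations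
(`coord_wedge_eq_zero`), and the result is carried back to the manifold by the basis of coordinate
vectors.
-/

noncomputable section

namespace QuasiEinstein

/-! ### Tensor calculus over a ring with commuting derivations -/

section Algebra

variable {ι A : Type*} [CommRing A] [Algebra ℝ A]

theorem map_derivation_add (d : Derivation ℝ A A) (X Y : Matrix ι ι A) :
    (X + Y).map d = X.map d + Y.map d := by
  ext; simp

theorem map_derivation_sub (d : Derivation ℝ A A) (X Y : Matrix ι ι A) :
    (X - Y).map d = X.map d - Y.map d := by
  ext; simp

theorem map_derivation_neg (d : Derivation ℝ A A) (X : Matrix ι ι A) :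
    (-X).map d = -X.map d := by
  ext; simp

variable [Fintype ι]

theorem map_derivation_mul (d : Derivation ℝ A A) (X Y : Matrix ι ι A) :
    (X * Y).map d = X.map d * Y + X * Y.map d := by
  ext i j
  simp only [Matrix.map_apply, Matrix.mul_apply, Matrix.add_apply, map_sum, Derivation.leibniz,
    smul_eq_mul, ← Finset.sum_add_distrib]
  exact Finset.sum_congr rfl fun k _ ↦ by ring

/-- The curvature `F_ij = ∂_i Γ_j - ∂_j Γ_i + Γ_i Γ_j - Γ_j Γ_i` of the connection with matrices
`Γ_i = (Γ^l_ik)_{lk}`, over a commutative ring with derivations `D i` in the role of `∂_i`. -/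
def curvature (D : ι → Derivation ℝ A A) (Γ : ι → Matrix ι ι A) (i j : ι) : Matrix ι ι A :=
  (Γ j).map (D i) - (Γ i).map (D j) + Γ i * Γ j - Γ j * Γ i

/-- The algebraic properties of the Levi-Civita connection `Γ` of a metric with inverse `h`: the
derivations `D i` commute, `Γ` is torsion free, and `h` is symmetric and parallel. -/
structure IsLeviCivita (D : ι → Derivation ℝ A A) (h : Matrix ι ι A) (Γ : ι → Matrix ι ι A) :
    Prop where
  comm : ∀ i j a, D i (D j a) = D j (D i a)
  torsion_free : ∀ i j l, Γ i l j = Γ j l i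
  symm : hᵀ = h
  parallel : ∀ m, h.map (D m) = -(Γ m * h + h * (Γ m)ᵀ)

variable {D : ι → Derivation ℝ A A} {h : Matrix ι ι A} {Γ : ι → Matrix ι ι A}

/-- The Ricci tensor `Ric_jk = ∑_i R^i_ijk`, the trace of the curvature `R^l_ijk = (F_ij)_{lk}`. -/
def ricciForm (D : ι → Derivation ℝ A A) (Γ : ι → Matrix ι ι A) : Matrix ι ι A :=
  .of fun j k ↦ ∑ i, curvature D Γ i j i k

/-- The divergence `∇_j T_m^j = ∂_j T_m^j + Γ^j_ja T_m^a - Γ^i_ma T_i^a` of a tensor of type `(1,1)`,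
with the lower index as the row index of the matrix `T`. -/
def divergence (D : ι → Derivation ℝ A A) (Γ : ι → Matrix ι ι A) (T : Matrix ι ι A) (m : ι) : A :=
  ∑ j, D j (T m j) + ∑ j, ∑ a, Γ j j a * T m a - ∑ i, ∑ a, Γ m i a * T i a

namespace IsLeviCivita

theorem map_comm (hL : IsLeviCivita D h Γ) (i j : ι) (X : Matrix ι ι A) :
    (X.map (D j)).map (D i) = (X.map (D i)).map (D j) := by
  ext; simp [hL.comm i j]

/-- The second Bianchi identity for the covariant derivatives `∂_m F + [Γ_m, F]` that treat the
values of `F_ij` as endomorphisms. The terms that `∇_m` adds for the indices `i`, `j` would cancel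
in the cyclic sum, by torsion freeness. -/
theorem bianchi (hL : IsLeviCivita D h Γ) (m i j : ι) :
    ((curvature D Γ i j).map (D m) + Γ m * curvature D Γ i j - curvature D Γ i j * Γ m) +
    ((curvature D Γ j m).map (D i) + Γ i * curvature D Γ j m - curvature D Γ j m * Γ i) +
    ((curvature D Γ m i).map (D j) + Γ j * curvature D Γ m i - curvature D Γ m i * Γ j) = 0 := by
  simp only [curvature, map_derivation_mul, map_derivation_add, map_derivation_sub]
  rw [hL.map_comm i m, hL.map_comm j m, hL.map_comm j i]
  noncomm_ring

theorem curvature_antisymm (i j : ι) : curvature D Γ j i = -curvature D Γ i j := by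
  simp only [curvature]; abel

/-- Raising an index makes the curvature skew: this is the equality of the mixed derivatives
`∂_i ∂_j h` and `∂_j ∂_i h`, both computed from `∇h = 0`. -/
theorem raised_skew (hL : IsLeviCivita D h Γ) (i j : ι) :
    (curvature D Γ i j * h)ᵀ = -(curvature D Γ i j * h) := by
  have key := hL.map_comm i j h
  have ht (X : Matrix ι ι A) (k : ι) : Xᵀ.map (D k) = (X.map (D k))ᵀ := rfl
  simp only [hL.parallel, map_derivation_mul, map_derivation_add, map_derivation_neg, ht] at key
  simp only [curvature, Matrix.transpose_mul, Matrix.transpose_add, Matrix.transpose_sub, hL.symm]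
  rw [← sub_eq_zero] at key ⊢
  rw [← neg_eq_zero, ← key]
  noncomm_ring

/-- The second Bianchi identity for the curvature `F_ij h` with a raised index. -/
theorem raised_bianchi (hL : IsLeviCivita D h Γ) (m i j : ι) :
    ((curvature D Γ i j * h).map (D m) + Γ m * (curvature D Γ i j * h)
      + (curvature D Γ i j * h) * (Γ m)ᵀ) +
    ((curvature D Γ j m * h).map (D i) + Γ i * (curvature D Γ j m * h)
      + (curvature D Γ j m * h) * (Γ i)ᵀ) +
    ((curvature D Γ m i * h).map (D j) + Γ j * (curvature D Γ m i * h)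
      + (curvature D Γ m i * h) * (Γ j)ᵀ) = 0 := by
  have key := congrArg (· * h) (hL.bianchi m i j)
  simp only [zero_mul] at key
  rw [← key]
  simp only [map_derivation_mul, hL.parallel]
  noncomm_ring

/-- The contracted Bianchi identity `∂_m R = 2 ∇_j Ric_m^j`. It is the double trace, over `i` and
`j`, of the entry `(i, j)` of the Bianchi identity with a raised index. -/
theorem contracted_bianchi (hL : IsLeviCivita D h Γ) (m : ι) :
    D m (ricciForm D Γ * h).trace = 2 * divergence D Γ (ricciForm D Γ * h) m := by
  -- `K i j l k` is `R^l_ija h^{ak}`, skew in `i, j` and in `l, k`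
  set K : ι → ι → Matrix ι ι A := fun i j ↦ curvature D Γ i j * h with hK
  have hK1 (i j l k) : K i j k l = -K i j l k := congrFun₂ (hL.raised_skew i j) l k
  have hK2 (i j l k) : K j i l k = -K i j l k := by
    simp only [hK, curvature_antisymm (D := D) (Γ := Γ) i j, neg_mul, Matrix.neg_apply]
  have hρ (j k) : (ricciForm D Γ * h) j k = ∑ i, K i j i k := by
    simp only [ricciForm, hK, Matrix.mul_apply, Matrix.of_apply, Finset.sum_mul]
    exact Finset.sum_comm
  have hB (i j : ι) := congrFun₂ (hL.raised_bianchi m i j) i j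
  have hsum : ∑ i, ∑ j, _ = (0 : A) :=
    Finset.sum_eq_zero fun i _ ↦ Finset.sum_eq_zero fun j _ ↦ hB i j
  change ∑ i, ∑ j, ((K i j).map (D m) + Γ m * K i j + K i j * (Γ m)ᵀ +
    ((K j m).map (D i) + Γ i * K j m + K j m * (Γ i)ᵀ) +
    ((K m i).map (D j) + Γ j * K m i + K m i * (Γ j)ᵀ)) i j = 0 at hsum
  simp only [Matrix.add_apply, Matrix.map_apply, Matrix.mul_apply, Matrix.transpose_apply,
    Finset.sum_add_distrib] at hsum
  -- the nine contractions, each expressed through the Ricci tensor `ρ`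
  have e1 : ∑ i, ∑ j, D m (K i j i j) = D m (ricciForm D Γ * h).trace := by
    simp only [Matrix.trace, Matrix.diag, hρ, map_sum]
    exact Finset.sum_comm
  have e2 : ∑ i, ∑ j, ∑ a, Γ m i a * K i j a j = ∑ i, ∑ a, Γ m i a * (ricciForm D Γ * h) i a := by
    refine Finset.sum_congr rfl fun i _ ↦ ?_
    rw [Finset.sum_comm]
    refine Finset.sum_congr rfl fun a _ ↦ ?_
    rw [hρ, Finset.mul_sum]
    refine Finset.sum_congr rfl fun j _ ↦ ?_
    rw [hK1 i j j a, hK2 j i j a, neg_neg]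
  have e3 : ∑ i, ∑ j, ∑ a, K i j i a * Γ m j a = ∑ i, ∑ a, Γ m i a * (ricciForm D Γ * h) i a := by
    rw [Finset.sum_comm]
    refine Finset.sum_congr rfl fun j _ ↦ ?_
    rw [Finset.sum_comm]
    refine Finset.sum_congr rfl fun a _ ↦ ?_
    rw [hρ, Finset.mul_sum]
    exact Finset.sum_congr rfl fun i _ ↦ mul_comm _ _
  have e4 : ∑ i, ∑ j, D i (K j m i j) = -∑ j, D j ((ricciForm D Γ * h) m j) := by
    simp only [hρ, map_sum, ← Finset.sum_neg_distrib]
    refine Finset.sum_congr rfl fun i _ ↦ Finset.sum_congr rfl fun j _ ↦ ?_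
    rw [hK1 j m j i, map_neg]
  have e5 : ∑ i, ∑ j, ∑ a, Γ i i a * K j m a j = -∑ j, ∑ a, Γ j j a * (ricciForm D Γ * h) m a := by
    simp only [hρ, ← Finset.sum_neg_distrib, Finset.mul_sum]
    refine Finset.sum_congr rfl fun i _ ↦ ?_
    rw [Finset.sum_comm]
    refine Finset.sum_congr rfl fun a _ ↦ Finset.sum_congr rfl fun j _ ↦ ?_
    rw [hK1 j m j a, mul_neg]
  have two_cancel {x : A} (hx : x = -x) : x = 0 := by
    have h2 : (2 : ℝ) • x = 0 := by rw [two_smul]; nth_rw 2 [hx]; exact add_neg_cancel x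
    simpa using congrArg ((1 / 2 : ℝ) • ·) h2
  -- a skew tensor contracted with the symmetric lower indices of `Γ` vanishes
  have e6 : ∑ i, ∑ j, ∑ a, K j m i a * Γ i j a = 0 := by
    apply two_cancel
    rw [Finset.sum_comm]
    simp only [← Finset.sum_neg_distrib]
    refine Finset.sum_congr rfl fun j _ ↦ ?_
    conv_rhs => rw [Finset.sum_comm]
    refine Finset.sum_congr rfl fun a _ ↦ Finset.sum_congr rfl fun i _ ↦ ?_
    rw [hK1 j m i a, hL.torsion_free a i j, neg_mul]
  have e7 : ∑ i, ∑ j, D j (K m i i j) = -∑ j, D j ((ricciForm D Γ * h) m j) := by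
    rw [Finset.sum_comm]
    simp only [hρ, map_sum, ← Finset.sum_neg_distrib]
    refine Finset.sum_congr rfl fun i _ ↦ Finset.sum_congr rfl fun j _ ↦ ?_
    rw [hK2 j m j i, map_neg]
  have e8 : ∑ i, ∑ j, ∑ a, Γ j i a * K m i a j = 0 := by
    apply two_cancel
    simp only [← Finset.sum_neg_distrib]
    refine Finset.sum_congr rfl fun i _ ↦ ?_
    conv_rhs => rw [Finset.sum_comm]
    refine Finset.sum_congr rfl fun j _ ↦ Finset.sum_congr rfl fun a _ ↦ ?_
    rw [hK1 m i j a, hL.torsion_free a j i, mul_neg]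
  have e9 : ∑ i, ∑ j, ∑ a, K m i i a * Γ j j a = -∑ j, ∑ a, Γ j j a * (ricciForm D Γ * h) m a := by
    rw [Finset.sum_comm]
    simp only [hρ, ← Finset.sum_neg_distrib, Finset.mul_sum]
    refine Finset.sum_congr rfl fun j _ ↦ ?_
    rw [Finset.sum_comm]
    refine Finset.sum_congr rfl fun a _ ↦ Finset.sum_congr rfl fun i _ ↦ ?_
    rw [hK2 i m i a, neg_mul, mul_comm]
  rw [e1, e2, e3, e4, e5, e6, e7, e8, e9] at hsum
  rw [divergence]
  linear_combination hsum

end IsLeviCivita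

/-- The covariant derivative `∇_m v^j` of a vector field `v`, with row index `m`. -/
def covDeriv (D : ι → Derivation ℝ A A) (Γ : ι → Matrix ι ι A) (v : ι → A) : Matrix ι ι A :=
  .of fun m j ↦ D m (v j) + ∑ a, Γ m j a * v a

/-- The Hessian `∂_i ∂_k u - Γ^l_ik ∂_l u`. -/
def hessianForm (D : ι → Derivation ℝ A A) (Γ : ι → Matrix ι ι A) (u : A) : Matrix ι ι A :=
  .of fun i k ↦ D i (D k u) - ∑ l, Γ i l k * D l u

/-- The gradient `h^{ka} ∂_a u`. -/
def grad (D : ι → Derivation ℝ A A) (h : Matrix ι ι A) (u : A) (k : ι) : A :=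
  ∑ a, h k a * D a u

/-- The squared norm `h^{ka} ∂_k u ∂_a u` of the gradient. -/
def normSqGrad (D : ι → Derivation ℝ A A) (h : Matrix ι ι A) (u : A) : A :=
  ∑ k, D k u * grad D h u k

theorem divergence_add (S T : Matrix ι ι A) (m : ι) :
    divergence D Γ (S + T) m = divergence D Γ S m + divergence D Γ T m := by
  simp only [divergence, Matrix.add_apply, map_add, mul_add, Finset.sum_add_distrib]
  ring

namespace IsLeviCivita

/-- The contracted Ricci identity `∇_j ∇_m v^j = ∂_m (div v) + Ric_mb v^b` for vector fields. -/
theorem divergence_covDeriv (hL : IsLeviCivita D h Γ) (v : ι → A) (m : ι) :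
    divergence D Γ (covDeriv D Γ v) m
      = D m (covDeriv D Γ v).trace + ∑ b, ricciForm D Γ m b * v b := by
  have e1 : ∑ b, ricciForm D Γ m b * v b = ∑ j, ∑ b, D j (Γ m j b) * v b
      - ∑ j, ∑ b, D m (Γ j j b) * v b + ∑ j, ∑ a, ∑ b, Γ j j a * (Γ m a b * v b)
      - ∑ j, ∑ a, ∑ b, Γ m j a * (Γ j a b * v b) := by
    simp only [ricciForm, curvature, Matrix.of_apply, Matrix.sub_apply, Matrix.add_apply,
      Matrix.map_apply, Matrix.mul_apply, Finset.sum_mul, ← Finset.sum_sub_distrib,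
      ← Finset.sum_add_distrib]
    rw [Finset.sum_comm]
    refine Finset.sum_congr rfl fun j _ ↦ ?_
    simp only [Finset.sum_sub_distrib, Finset.sum_add_distrib, sub_mul, add_mul, Finset.sum_mul,
      mul_assoc]
    rw [Finset.sum_comm (f := fun b a ↦ Γ j j a * (Γ m a b * v b)),
      Finset.sum_comm (f := fun b a ↦ Γ m j a * (Γ j a b * v b))]
  rw [e1]
  simp only [divergence, covDeriv, Matrix.trace, Matrix.diag, Matrix.of_apply, map_add, map_sum,
    Derivation.leibniz, smul_eq_mul, mul_add, Finset.mul_sum, Finset.sum_add_distrib,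
    hL.comm m]
  simp only [mul_comm (v _)]
  ring

/-- The Hessian with an index raised is the covariant derivative of the gradient, because `h` is
parallel. -/
theorem hessianForm_mul (hL : IsLeviCivita D h Γ) (u : A) :
    hessianForm D Γ u * h = covDeriv D Γ (grad D h u) := by
  ext m j
  have hp (a) := congrFun₂ (hL.parallel m) j a
  simp only [Matrix.map_apply, Matrix.neg_apply, Matrix.add_apply, Matrix.mul_apply,
    Matrix.transpose_apply] at hp
  have hs (a) : h a j = h j a := congrFun₂ hL.symm j a
  simp only [covDeriv, grad, hessianForm, Matrix.mul_apply, Matrix.of_apply, map_sum,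
    Derivation.leibniz, smul_eq_mul, hp, sub_mul, mul_neg, mul_add, Finset.mul_sum, Finset.sum_mul,
    Finset.sum_add_distrib, Finset.sum_sub_distrib, Finset.sum_neg_distrib, hs]
  rw [Finset.sum_comm (f := fun a b ↦ D a u * (Γ m j b * h b a)),
    Finset.sum_comm (f := fun a b ↦ Γ m b a * D b u * h j a)]
  simp only [mul_comm, mul_left_comm]
  ring_nf

/-- The raised Hessian applied to `du` is the Hessian applied to `∇u`. -/
theorem sum_hessianForm_mul_grad (u : A) (m : ι) :
    ∑ j, (hessianForm D Γ u * h) m j * D j u = ∑ k, hessianForm D Γ u m k * grad D h u k := by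
  simp only [Matrix.mul_apply, grad, Finset.sum_mul, Finset.mul_sum]
  rw [Finset.sum_comm]
  simp only [mul_assoc]

/-- The formula `½ ∂_m ‖∇u‖² = (∇²u)(∂_m, ∇u)`. -/
theorem derivation_normSqGrad (hL : IsLeviCivita D h Γ) (u : A) (m : ι) :
    D m (normSqGrad D h u) = 2 * ∑ k, hessianForm D Γ u m k * grad D h u k := by
  have e1 : ∑ k, hessianForm D Γ u m k * grad D h u k = ∑ k, D m (D k u) * grad D h u k
      - ∑ k, ∑ a, Γ m k a * D k u * grad D h u a := by
    simp only [hessianForm, Matrix.of_apply, sub_mul, Finset.sum_mul, Finset.sum_sub_distrib]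
    rw [Finset.sum_comm]
  have e2 := sum_hessianForm_mul_grad (D := D) (h := h) (Γ := Γ) u m
  rw [hL.hessianForm_mul] at e2
  simp only [covDeriv, Matrix.of_apply, add_mul, Finset.sum_mul, Finset.sum_add_distrib] at e2
  simp only [normSqGrad, map_sum, Derivation.leibniz, smul_eq_mul, Finset.sum_add_distrib]
  rw [two_mul]
  nth_rw 1 [← e2]
  rw [e1]
  simp only [mul_comm, mul_left_comm]
  ring_nf

theorem divergence_smul_one [DecidableEq ι] (hL : IsLeviCivita D h Γ) (c : A) (m : ι) :
    divergence D Γ (c • (1 : Matrix ι ι A)) m = D m c := by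
  simp only [divergence, Matrix.smul_apply, Matrix.one_apply, smul_eq_mul, mul_one,
    mul_zero, apply_ite, map_zero, Finset.sum_ite_eq, Finset.mem_univ, if_true]
  simp [hL.torsion_free m]

/-- The divergence of `ν df ⊗ ∇f`, which is `(⟨∇ν, ∇f⟩ + ν Δf) df + ½ ν d‖∇f‖²`. -/
theorem divergence_tensor (hL : IsLeviCivita D h Γ) (f ν : A) (m : ι) :
    2 * divergence D Γ (.of fun i j ↦ ν * (D i f * grad D h f j)) m
      = 2 * (∑ j, D j ν * grad D h f j + ν * (hessianForm D Γ f * h).trace) * D m f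
        + ν * D m (normSqGrad D h f) := by
  rw [hL.derivation_normSqGrad, hL.hessianForm_mul]
  have hH (j) : hessianForm D Γ f m j = D j (D m f) - ∑ l, Γ m l j * D l f := by
    rw [hessianForm, Matrix.of_apply, hL.comm]
  simp only [hH, divergence, covDeriv, Matrix.trace, Matrix.diag, Matrix.of_apply,
    Derivation.leibniz, smul_eq_mul, mul_add, add_mul, sub_mul, Finset.mul_sum, Finset.sum_mul,
    Finset.sum_add_distrib, Finset.sum_sub_distrib, mul_sub]
  rw [Finset.sum_comm (f := fun a b ↦ ν * (2 * (Γ m b a * D b f * grad D h f a)))]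
  simp only [mul_comm, mul_left_comm]
  ring_nf

variable [DecidableEq ι]

/-- Modulo multiples of `df`, the form `2 S dν + (ν - 1) dS`, where `S = ‖∇f‖²`, is exact. This is
the divergence of the quasi-Einstein equation, with `d Δf` eliminated by the trace of the equation
and `Ric(∇f)` by the equation itself. -/
theorem derivation_scalar (hL : IsLeviCivita D h Γ) {G : Matrix ι ι A} (hG : G * h = 1)
    {f lam ν : A}
    (heq : ∀ i j, ricciForm D Γ i j + hessianForm D Γ f i j - ν * (D i f * D j f)
      = lam * G i j) :
    ∃ R B : A, ∀ m, D m R = 2 * normSqGrad D h f * D m ν + (ν - 1) * D m (normSqGrad D h f)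
      + B * D m f := by
  set S := normSqGrad D h f with hS
  set w := grad D h f with hw
  set T := (hessianForm D Γ f * h).trace with hT
  set R := (ricciForm D Γ * h).trace with hR
  have hs (i j) : h i j = h j i := congrFun₂ hL.symm j i
  have heqM : ricciForm D Γ + hessianForm D Γ f = lam • G + .of fun i j ↦ ν * (D i f * D j f) := by
    ext i j
    simp only [Matrix.add_apply, Matrix.smul_apply, Matrix.of_apply, smul_eq_mul]
    linear_combination heq i j
  have hmix : ricciForm D Γ * h + hessianForm D Γ f * h
      = lam • (1 : Matrix ι ι A) + .of fun i j ↦ ν * (D i f * w j) := by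
    rw [← add_mul, heqM, add_mul, smul_mul_assoc, hG]
    congr 1
    ext i j
    simp only [Matrix.mul_apply, Matrix.of_apply, hw, grad, Finset.mul_sum]
    exact Finset.sum_congr rfl fun k _ ↦ by rw [hs k j]; ring
  have htr : R + T = Fintype.card ι * lam + ν * S := by
    have := congrArg Matrix.trace hmix
    rw [Matrix.trace_add, Matrix.trace_add, Matrix.trace_smul, Matrix.trace_one] at this
    rw [hR, hT, this, hS, normSqGrad, Finset.mul_sum, smul_eq_mul, mul_comm lam]
    rfl
  have hGw (m) : ∑ b, G m b * w b = D m f := by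
    have : G *ᵥ (h *ᵥ fun a ↦ D a f) = fun a ↦ D a f := by
      rw [Matrix.mulVec_mulVec, hG, Matrix.one_mulVec]
    exact congrFun this m
  have hric (m) : 2 * ∑ b, ricciForm D Γ m b * w b
      = 2 * (lam + ν * S) * D m f - D m S := by
    have e (b) : ricciForm D Γ m b * w b = lam * (G m b * w b) + ν * D m f * (D b f * w b)
        - hessianForm D Γ f m b * w b := by
      linear_combination w b * heq m b
    rw [hL.derivation_normSqGrad]
    simp only [e, Finset.sum_add_distrib, Finset.sum_sub_distrib, ← Finset.mul_sum, hGw]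
    rw [hS, normSqGrad]
    ring
  -- the function called `R` in the statement is the scalar curvature minus `2 (n - 1) lam`
  refine ⟨R - 2 * ((Fintype.card ι : A) * lam - lam),
    2 * (lam + ν * S) - 2 * (∑ j, D j ν * w j + ν * T), fun m ↦ ?_⟩
  have hdiv := congrArg (fun X ↦ 2 * divergence D Γ X m) hmix
  simp only [divergence_add, mul_add, hL.divergence_smul_one, hL.divergence_tensor,
    ← hL.contracted_bianchi, hw] at hdiv
  rw [hL.hessianForm_mul, hL.divergence_covDeriv, mul_add, ← hw, hric m, ← hL.hessianForm_mul,
    ← hT, ← hR, ← hS] at hdiv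
  have htr' := congrArg (D m) htr
  simp only [map_add, Derivation.leibniz, smul_eq_mul, Derivation.map_natCast, mul_zero,
    add_zero] at htr'
  have h2 : D m (2 : A) = 0 := by simpa using (D m).map_natCast 2
  simp only [map_sub, Derivation.leibniz, smul_eq_mul, Derivation.map_natCast, h2, mul_zero,
    add_zero]
  linear_combination 2 * htr' - hdiv

/-- The identity `dS ∧ dν ∧ df = 0` for `S = ‖∇f‖²`, in components. -/
theorem wedge_eq_zero (hL : IsLeviCivita D h Γ) {G : Matrix ι ι A} (hG : G * h = 1)
    {f lam ν : A}
    (heq : ∀ i j, ricciForm D Γ i j + hessianForm D Γ f i j - ν * (D i f * D j f)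
      = lam * G i j) (i j k : ι) :
    D i (normSqGrad D h f) * (D j ν * D k f - D k ν * D j f)
      - D j (normSqGrad D h f) * (D i ν * D k f - D k ν * D i f)
      + D k (normSqGrad D h f) * (D i ν * D j f - D j ν * D i f) = 0 := by
  obtain ⟨R, B, hR⟩ := hL.derivation_scalar hG heq
  -- the exterior derivative of the identity for `dR`
  have hd (a b) : D a (normSqGrad D h f) * D b ν - D b (normSqGrad D h f) * D a ν
      + D a B * D b f - D b B * D a f = 0 := by
    have e := hL.comm a b R
    have h2 (a) : D a (2 : A) = 0 := by simpa using (D a).map_natCast 2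
    rw [hR, hR] at e
    simp only [map_add, map_sub, Derivation.leibniz, smul_eq_mul, h2, Derivation.map_one_eq_zero,
      mul_zero, add_zero, sub_zero] at e
    rw [hL.comm b a ν, hL.comm b a f, hL.comm b a (normSqGrad D h f)] at e
    linear_combination e
  linear_combination D k f * hd i j + D i f * hd j k - D j f * hd i k

end IsLeviCivita

variable [DecidableEq ι]

/-- The Christoffel formula defines a Levi-Civita connection. -/
theorem isLeviCivita_of_christoffel (hcomm : ∀ i j a, D i (D j a) = D j (D i a))
    {G h : Matrix ι ι A} (hGs : Gᵀ = G) (hGh : G * h = 1) {Γ : ι → Matrix ι ι A}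
    (hΓ : ∀ i k j, Γ i k j
      = (1 / 2 : ℝ) • ∑ l, h k l * (D i (G j l) + D j (G i l) - D l (G i j))) :
    IsLeviCivita D h Γ := by
  have hhG : h * G = 1 := mul_eq_one_comm.1 hGh
  have hhs : hᵀ = h := by
    calc hᵀ = hᵀ * (G * h) := by rw [hGh, mul_one]
      _ = (G * h)ᵀ * h := by rw [Matrix.transpose_mul, hGs, mul_assoc]
      _ = h := by rw [hGh, Matrix.transpose_one, one_mul]
  have hG (i j) : G i j = G j i := congrFun₂ hGs j i
  refine ⟨hcomm, fun i j l ↦ ?_, hhs, fun m ↦ ?_⟩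
  · rw [hΓ, hΓ]
    congr 1
    refine Finset.sum_congr rfl fun a _ ↦ ?_
    rw [hG i j]
    ring
  · -- lowering an index gives the Christoffel symbols of the first kind
    have hlow : G * Γ m
        = .of fun l k ↦ (1 / 2 : ℝ) • (D m (G k l) + D k (G m l) - D l (G m k)) := by
      have hΓm : Γ m = h * .of fun l k ↦
          (1 / 2 : ℝ) • (D m (G k l) + D k (G m l) - D l (G m k)) := by
        ext l k
        simp [Matrix.mul_apply, hΓ, Finset.smul_sum]
      rw [hΓm, ← mul_assoc, hGh, one_mul]
    have hDG : G.map (D m) = G * Γ m + (G * Γ m)ᵀ := by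
      rw [hlow]
      ext l k
      simp only [Matrix.map_apply, Matrix.add_apply, Matrix.of_apply, Matrix.transpose_apply]
      rw [← smul_add, hG k l]
      have : D m (G l k) + D k (G m l) - D l (G m k) + (D m (G l k) + D l (G m k) - D k (G m l))
          = (2 : ℝ) • D m (G l k) := by
        rw [two_smul]; ring
      rw [this, smul_smul]
      norm_num
    have h0 : h.map (D m) * G + h * G.map (D m) = 0 := by
      rw [← map_derivation_mul, hhG]
      ext i j
      by_cases hij : i = j <;> simp [hij]
    calc h.map (D m) = h.map (D m) * G * h := by rw [mul_assoc, hGh, mul_one]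
      _ = -(h * (G * Γ m + (Γ m)ᵀ * G)) * h := by
        rw [eq_neg_of_add_eq_zero_left h0, hDG, Matrix.transpose_mul, hGs]
      _ = -(h * G * Γ m * h + h * (Γ m)ᵀ * (G * h)) := by noncomm_ring
      _ = _ := by rw [hhG, hGh, one_mul, mul_one]

end Algebra

/-! ### Smooth functions on an open set of `ℝⁿ` -/

section SmoothFunctions

variable {n : ℕ} {U : TopologicalSpace.Opens (EuclideanSpace ℝ (Fin n))}

/-- The algebra of smooth functions on an open set of `ℝⁿ`, realized as the functions on the subtype
`U` that are restrictions of functions on `ℝⁿ` which are smooth on `U`. -/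
def smoothAlgebra (U : TopologicalSpace.Opens (EuclideanSpace ℝ (Fin n))) :
    Subalgebra ℝ (U → ℝ) where
  carrier := {u | ∃ v : EuclideanSpace ℝ (Fin n) → ℝ, ContDiffOn ℝ ∞ v U ∧ ∀ y : U, v y = u y}
  mul_mem' := by
    rintro a b ⟨v, hv, hva⟩ ⟨w, hw, hwb⟩
    exact ⟨v * w, hv.mul hw, fun y ↦ by simp [hva, hwb]⟩
  add_mem' := by
    rintro a b ⟨v, hv, hva⟩ ⟨w, hw, hwb⟩
    exact ⟨v + w, hv.add hw, fun y ↦ by simp [hva, hwb]⟩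
  algebraMap_mem' r := ⟨fun _ ↦ r, contDiffOn_const, fun _ ↦ rfl⟩

/-- The restriction to `U` of a function that is smooth on `U`, as an element of the algebra. -/
def res (v : EuclideanSpace ℝ (Fin n) → ℝ) (hv : ContDiffOn ℝ ∞ v U) : smoothAlgebra U :=
  ⟨fun y ↦ v y, v, hv, fun _ ↦ rfl⟩

@[simp] theorem res_apply {v : EuclideanSpace ℝ (Fin n) → ℝ} (hv : ContDiffOn ℝ ∞ v U) (y : U) :
    (res v hv).1 y = v y := rfl

theorem exists_res (u : smoothAlgebra U) :
    ∃ (v : EuclideanSpace ℝ (Fin n) → ℝ) (hv : ContDiffOn ℝ ∞ v U), u = res v hv := by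
  obtain ⟨u, v, hv, h⟩ := u
  exact ⟨v, hv, Subtype.ext (funext fun y ↦ (h y).symm)⟩

theorem contDiffOn_pd {v : EuclideanSpace ℝ (Fin n) → ℝ} (hv : ContDiffOn ℝ ∞ v U) (i : Fin n) :
    ContDiffOn ℝ ∞ (pd i v) U :=
  (hv.fderiv_of_isOpen U.isOpen (by simp)).clm_apply contDiffOn_const

theorem differentiableAt_of_mem {v : EuclideanSpace ℝ (Fin n) → ℝ} (hv : ContDiffOn ℝ ∞ v U)
    (y : U) : DifferentiableAt ℝ v y :=
  (hv.contDiffAt (U.isOpen.mem_nhds y.2)).differentiableAt (by simp)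

theorem pd_congr {v w : EuclideanSpace ℝ (Fin n) → ℝ} (h : ∀ y : U, v y = w y) (i : Fin n)
    (y : U) : pd i v y = pd i w y := by
  have : v =ᶠ[nhds (y : EuclideanSpace ℝ (Fin n))] w := by
    filter_upwards [U.isOpen.mem_nhds y.2] with z hz using h ⟨z, hz⟩
  rw [pd, pd, this.fderiv_eq]

/-- The partial derivative of a smooth function on `U`, computed from an arbitrary extension to
`ℝⁿ`. -/
def partialDeriv (i : Fin n) (u : smoothAlgebra U) : smoothAlgebra U :=
  res (pd i (exists_res u).choose) (contDiffOn_pd (exists_res u).choose_spec.choose i)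

theorem partialDeriv_res {v : EuclideanSpace ℝ (Fin n) → ℝ} (hv : ContDiffOn ℝ ∞ v U)
    (i : Fin n) : partialDeriv i (res v hv) = res (pd i v) (contDiffOn_pd hv i) := by
  refine Subtype.ext (funext fun y ↦ pd_congr (fun z ↦ ?_) i y)
  exact (congrFun (congrArg Subtype.val (exists_res (res v hv)).choose_spec.choose_spec) z).symm

/-- The partial derivatives as derivations of the algebra of smooth functions. -/
def partialDerivation (i : Fin n) : Derivation ℝ (smoothAlgebra U) (smoothAlgebra U) :=
  Derivation.mk'
    { toFun := partialDeriv i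
      map_add' := fun a b ↦ by
        obtain ⟨v, hv, rfl⟩ := exists_res a
        obtain ⟨w, hw, rfl⟩ := exists_res b
        rw [show res v hv + res w hw = res (v + w) (hv.add hw) from rfl]
        simp only [partialDeriv_res]
        ext y
        change pd i (v + w) y = pd i v y + pd i w y
        simp only [pd, fderiv_add (differentiableAt_of_mem hv y) (differentiableAt_of_mem hw y),
          add_apply]
      map_smul' := fun c a ↦ by
        obtain ⟨v, hv, rfl⟩ := exists_res a
        rw [show c • res v hv = res (c • v) (hv.const_smul c) from rfl]
        simp only [partialDeriv_res]
        ext y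
        change pd i (c • v) y = c • pd i v y
        simp only [pd, fderiv_const_smul (differentiableAt_of_mem hv y),
          smul_apply] }
    fun a b ↦ by
      obtain ⟨v, hv, rfl⟩ := exists_res a
      obtain ⟨w, hw, rfl⟩ := exists_res b
      rw [show res v hv * res w hw = res (v * w) (hv.mul hw) from rfl]
      change partialDeriv i _ = _ • partialDeriv i _ + _ • partialDeriv i _
      simp only [partialDeriv_res]
      ext y
      change pd i (v * w) y = v y * pd i w y + w y * pd i v y
      simp only [pd, fderiv_mul (differentiableAt_of_mem hv y) (differentiableAt_of_mem hw y),
        add_apply, smul_apply, smul_eq_mul]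

theorem partialDerivation_res {v : EuclideanSpace ℝ (Fin n) → ℝ} (hv : ContDiffOn ℝ ∞ v U)
    (i : Fin n) : partialDerivation i (res v hv) = res (pd i v) (contDiffOn_pd hv i) :=
  partialDeriv_res hv i

theorem partialDerivation_comm (i j : Fin n) (u : smoothAlgebra U) :
    partialDerivation i (partialDerivation j u) = partialDerivation j (partialDerivation i u) := by
  obtain ⟨v, hv, rfl⟩ := exists_res u
  simp only [partialDerivation_res]
  ext y
  change pd i (pd j v) y = pd j (pd i v) y
  have hc := hv.contDiffAt (U.isOpen.mem_nhds y.2)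
  have hd : DifferentiableAt ℝ (fderiv ℝ v) y :=
    (hc.fderiv_right (m := ∞) (by simp)).differentiableAt (by simp)
  have hsym := hc.isSymmSndFDerivAt (by
    rw [minSmoothness_of_isRCLikeNormedField]; exact WithTop.coe_le_coe.2 (le_top : (2 : ℕ∞) ≤ ⊤))
  have e (a b : Fin n) : pd a (pd b v) y
      = fderiv ℝ (fderiv ℝ v) y (EuclideanSpace.single a 1) (EuclideanSpace.single b 1) := by
    change fderiv ℝ (fun z ↦ fderiv ℝ v z (EuclideanSpace.single b 1)) y _ = _
    rw [fderiv_clm_apply hd (differentiableAt_const _)]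
    simp
  rw [e, e]
  exact hsym _ _

theorem contDiffOn_inv_apply {G : EuclideanSpace ℝ (Fin n) → Matrix (Fin n) (Fin n) ℝ}
    (hG : ∀ i j, ContDiffOn ℝ ∞ (fun y ↦ G y i j) U) (hdet : ∀ y ∈ U, (G y).det ≠ 0)
    (i j : Fin n) : ContDiffOn ℝ ∞ (fun y ↦ (G y)⁻¹ i j) U := by
  have hD (F : EuclideanSpace ℝ (Fin n) → Matrix (Fin n) (Fin n) ℝ)
      (hF : ∀ i j, ContDiffOn ℝ ∞ (fun y ↦ F y i j) U) :
      ContDiffOn ℝ ∞ (fun y ↦ (F y).det) U := by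
    simp only [Matrix.det_apply]
    exact ContDiffOn.sum fun σ _ ↦ (contDiffOn_prod fun k _ ↦ hF _ _).const_smul _
  simp only [Matrix.inv_def, Ring.inverse_eq_inv', Matrix.smul_apply, Matrix.adjugate_apply,
    smul_eq_mul]
  refine ((hD G hG).inv hdet).mul (hD _ fun a b ↦ ?_)
  by_cases hab : a = j
  · subst hab; simpa using contDiffOn_const
  · simpa [Matrix.updateRow_apply, hab] using hG a b

theorem contDiffOn_christoffel {G : EuclideanSpace ℝ (Fin n) → Matrix (Fin n) (Fin n) ℝ}
    (hG : ∀ i j, ContDiffOn ℝ ∞ (fun y ↦ G y i j) U) (hdet : ∀ y ∈ U, (G y).det ≠ 0)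
    (k i j : Fin n) : ContDiffOn ℝ ∞ (christoffel G k i j) U := by
  unfold christoffel
  exact contDiffOn_const.mul <| ContDiffOn.sum fun l _ ↦ (contDiffOn_inv_apply hG hdet k l).mul
    (((contDiffOn_pd (hG j l) i).add (contDiffOn_pd (hG i l) j)).sub (contDiffOn_pd (hG i j) l))

/-- The squared norm `h^{ka} ∂_k u ∂_a u` of the gradient in coordinates, where `h = G⁻¹`. -/
def coordNormSqGrad (G : EuclideanSpace ℝ (Fin n) → Matrix (Fin n) (Fin n) ℝ)
    (u : EuclideanSpace ℝ (Fin n) → ℝ) (y : EuclideanSpace ℝ (Fin n)) : ℝ :=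
  ∑ k, pd k u y * ∑ a, (G y)⁻¹ k a * pd a u y

theorem contDiffOn_coordNormSqGrad {G : EuclideanSpace ℝ (Fin n) → Matrix (Fin n) (Fin n) ℝ}
    (hG : ∀ i j, ContDiffOn ℝ ∞ (fun y ↦ G y i j) U) (hdet : ∀ y ∈ U, (G y).det ≠ 0)
    {u : EuclideanSpace ℝ (Fin n) → ℝ} (hu : ContDiffOn ℝ ∞ u U) :
    ContDiffOn ℝ ∞ (coordNormSqGrad G u) U :=
  ContDiffOn.sum fun k _ ↦ (contDiffOn_pd hu k).mul <| ContDiffOn.sum fun a _ ↦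
    (contDiffOn_inv_apply hG hdet k a).mul (contDiffOn_pd hu a)

@[simp] theorem add_val (u v : smoothAlgebra U) (y : U) : (u + v).1 y = u.1 y + v.1 y := rfl

@[simp] theorem sub_val (u v : smoothAlgebra U) (y : U) : (u - v).1 y = u.1 y - v.1 y := rfl

@[simp] theorem mul_val (u v : smoothAlgebra U) (y : U) : (u * v).1 y = u.1 y * v.1 y := rfl

@[simp] theorem smul_val (c : ℝ) (u : smoothAlgebra U) (y : U) : (c • u).1 y = c * u.1 y := rfl

@[simp] theorem sum_val {κ : Type*} (s : Finset κ) (u : κ → smoothAlgebra U) (y : U) :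
    (∑ k ∈ s, u k).1 y = ∑ k ∈ s, (u k).1 y := by
  have : (∑ k ∈ s, u k).1 = ∑ k ∈ s, (u k).1 := map_sum (smoothAlgebra U).subtype _ _
  rw [this, Finset.sum_apply]

/-- The identity `dS ∧ dν ∧ df = 0` for `S = ‖∇f‖²` in coordinates. -/
theorem coord_wedge_eq_zero {G : EuclideanSpace ℝ (Fin n) → Matrix (Fin n) (Fin n) ℝ}
    (hG : ∀ i j, ContDiffOn ℝ ∞ (fun y ↦ G y i j) U) (hdet : ∀ y ∈ U, (G y).det ≠ 0)
    (hsymm : ∀ y ∈ U, ∀ i j, G y i j = G y j i)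
    {f lam ν : EuclideanSpace ℝ (Fin n) → ℝ} (hf : ContDiffOn ℝ ∞ f U)
    (hlam : ContDiffOn ℝ ∞ lam U) (hν : ContDiffOn ℝ ∞ ν U)
    (heq : ∀ y ∈ U, ∀ i j, ricci G i j y + hessian G f i j y - ν y * (pd i f y * pd j f y)
      = lam y * G y i j) {y : EuclideanSpace ℝ (Fin n)} (hy : y ∈ U) (i j k : Fin n) :
    pd i (coordNormSqGrad G f) y * (pd j ν y * pd k f y - pd k ν y * pd j f y)
      - pd j (coordNormSqGrad G f) y * (pd i ν y * pd k f y - pd k ν y * pd i f y)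
      + pd k (coordNormSqGrad G f) y * (pd i ν y * pd j f y - pd j ν y * pd i f y) = 0 := by
  let G' : Matrix (Fin n) (Fin n) (smoothAlgebra U) := .of fun i j ↦ res _ (hG i j)
  let h' : Matrix (Fin n) (Fin n) (smoothAlgebra U) :=
    .of fun i j ↦ res _ (contDiffOn_inv_apply hG hdet i j)
  let Γ' : Fin n → Matrix (Fin n) (Fin n) (smoothAlgebra U) := fun i ↦
    .of fun k j ↦ res _ (contDiffOn_christoffel hG hdet k i j)
  have hGh : G' * h' = 1 := by
    ext a b y
    have e : (G y * (G y)⁻¹) a b = (1 : Matrix (Fin n) (Fin n) ℝ) a b := by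
      rw [Matrix.mul_nonsing_inv _ (hdet y y.2).isUnit]
    rw [Matrix.mul_apply] at e
    rw [Matrix.mul_apply, sum_val]
    refine Eq.trans e ?_
    by_cases hab : a = b
    · subst hab; simp
    · simp [hab]
  have hL : IsLeviCivita partialDerivation h' Γ' := by
    have hcomm : ∀ i j (a : smoothAlgebra U), partialDerivation i (partialDerivation j a)
        = partialDerivation j (partialDerivation i a) := partialDerivation_comm
    refine isLeviCivita_of_christoffel (A := smoothAlgebra U) (D := partialDerivation) hcomm
      (G := G') (h := h') (Γ := Γ') ?_ hGh ?_
    · ext a b y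
      exact hsymm y y.2 b a
    · intro a k b
      simp only [G', h', Γ', Matrix.of_apply, partialDerivation_res]
      ext y
      simp only [christoffel, res_apply, smul_val, sum_val, mul_val, add_val, sub_val]
  have key := hL.wedge_eq_zero (G := G') hGh (f := res f hf) (lam := res lam hlam)
    (ν := res ν hν) (fun a b ↦ ?_) i j k
  · have hS : normSqGrad (A := smoothAlgebra U) partialDerivation h' (res f hf)
        = res _ (contDiffOn_coordNormSqGrad hG hdet hf) := by
      ext y
      simp only [normSqGrad, grad, h', Matrix.of_apply, partialDerivation_res, coordNormSqGrad,
        res_apply, sum_val, mul_val]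
    rw [hS] at key
    simp only [partialDerivation_res] at key
    have key' := congrFun (congrArg Subtype.val key) ⟨y, hy⟩
    simp only [add_val, sub_val, mul_val, res_apply] at key'
    exact key'
  · ext y
    have h1 : (ricciForm (A := smoothAlgebra U) partialDerivation Γ' a b).1 y = ricci G a b y := by
      simp only [ricciForm, Matrix.of_apply, sum_val]
      rw [ricci]
      refine Finset.sum_congr rfl fun c _ ↦ ?_
      simp only [curvature, Matrix.sub_apply, Matrix.add_apply, Matrix.map_apply, Γ',
        Matrix.of_apply, partialDerivation_res, riemann, Finset.sum_sub_distrib, Matrix.mul_apply]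
      simp only [add_val, sub_val, sum_val, mul_val, res_apply]
      ring
    have h2 : (hessianForm (A := smoothAlgebra U) partialDerivation Γ' (res f hf) a b).1 y
        = hessian G f a b y := by
      simp only [hessianForm, Matrix.of_apply, partialDerivation_res, Γ', hessian, sub_val,
        sum_val, mul_val, res_apply]
    simp only [add_val, sub_val, mul_val, h1, h2, partialDerivation_res, res_apply, G',
      Matrix.of_apply, heq y y.2 a b]

end SmoothFunctions

/-! ### Charts of a Riemannian manifold -/

section Manifold

open Bundle

variable {n : ℕ} {M : Type*} [TopologicalSpace M] [ChartedSpace (EuclideanSpace ℝ (Fin n)) M]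
  [IsManifold (𝓡 n) ∞ M] {e : OpenPartialHomeomorph M (EuclideanSpace ℝ (Fin n))}

theorem mdifferentiable_chart (he : e ∈ atlas (EuclideanSpace ℝ (Fin n)) M) :
    e.MDifferentiable (𝓡 n) (𝓡 n) := by
  have : IsManifold (𝓡 n) 1 M := .of_le (n := ∞) (by simp)
  exact mdifferentiable_of_mem_atlas he

theorem contMDiffOn_chart_symm (he : e ∈ atlas (EuclideanSpace ℝ (Fin n)) M) :
    ContMDiffOn (𝓡 n) (𝓡 n) ∞ e.symm e.target :=
  contMDiffOn_symm_of_mem_maximalAtlas (IsManifold.subset_maximalAtlas he)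

/-- The coordinate vectors at a point, as a basis of the tangent space. -/
def coordBasis (he : e ∈ atlas (EuclideanSpace ℝ (Fin n)) M) {y : EuclideanSpace ℝ (Fin n)}
    (hy : y ∈ e.target) : Module.Basis (Fin n) ℝ (TangentSpace (𝓡 n) (e.symm y)) :=
  (EuclideanSpace.basisFun (Fin n) ℝ).toBasis.map
    ((mdifferentiable_chart he).symm.mfderiv hy).toLinearEquiv

@[simp] theorem coordBasis_apply (he : e ∈ atlas (EuclideanSpace ℝ (Fin n)) M)
    {y : EuclideanSpace ℝ (Fin n)} (hy : y ∈ e.target) (i : Fin n) :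
    coordBasis he hy i = coordVec e i y := by
  change mfderiv (𝓡 n) (𝓡 n) e.symm y ((EuclideanSpace.basisFun (Fin n) ℝ).toBasis i) = _
  rw [OrthonormalBasis.coe_toBasis, EuclideanSpace.basisFun_apply, coordVec]

theorem contMDiffOn_coordVec (he : e ∈ atlas (EuclideanSpace ℝ (Fin n)) M) (i : Fin n) :
    ContMDiffOn (𝓡 n) (𝓡 n).tangent ∞
      (fun y ↦ (⟨e.symm y, coordVec e i y⟩ : TangentBundle (𝓡 n) M)) e.target := by
  have : IsManifold (𝓡 n) 1 M := .of_le (n := ∞) (by simp)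
  have h1 := (contMDiffOn_chart_symm he).contMDiffOn_tangentMapWithin (m := ∞) (by simp)
    e.open_target.uniqueMDiffOn
  have h2 : ContMDiffOn (𝓡 n) (𝓡 n).tangent ∞
      (fun y ↦ (⟨y, (EuclideanSpace.single i (1 : ℝ) : EuclideanSpace ℝ (Fin n))⟩ :
        TangentBundle (𝓡 n) (EuclideanSpace ℝ (Fin n)))) e.target :=
    contMDiffOn_vectorSpace_iff_contDiffOn.2 contDiffOn_const
  refine (h1.comp h2 fun y hy ↦ hy).congr fun y hy ↦ ?_
  simp only [Function.comp_apply, tangentMapWithin, coordVec,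
    mfderivWithin_of_isOpen e.open_target hy]

variable (g : ContMDiffRiemannianMetric (𝓡 n) ∞ (EuclideanSpace ℝ (Fin n))
  (fun x : M ↦ TangentSpace (𝓡 n) x))

/-- The components of a smooth metric in a chart are smooth: they are the metric evaluated at the
coordinate vector fields. -/
theorem contDiffOn_metricMatrix (he : e ∈ atlas (EuclideanSpace ℝ (Fin n)) M) (i j : Fin n) :
    ContDiffOn ℝ ∞ (fun y ↦ metricMatrix g e y i j) e.target := by
  rw [← contMDiffOn_iff_contDiffOn]
  intro y hy
  have : ContMDiffWithinAt (𝓡 n) ((𝓡 n).prod 𝓘(ℝ)) ∞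
      (fun y ↦ TotalSpace.mk' ℝ (E := Bundle.Trivial M ℝ) (e.symm y)
        (g.inner (e.symm y) (coordVec e i y) (coordVec e j y))) e.target y := by
    apply ContMDiffWithinAt.clm_bundle_apply₂ (F₁ := EuclideanSpace ℝ (Fin n))
      (F₂ := EuclideanSpace ℝ (Fin n))
    · exact g.contMDiff.contMDiffAt.comp_contMDiffWithinAt y (contMDiffOn_chart_symm he y hy)
    · exact contMDiffOn_coordVec he i y hy
    · exact contMDiffOn_coordVec he j y hy
  simp only [contMDiffWithinAt_totalSpace] at this
  exact this.2

theorem metricMatrix_symm (y : EuclideanSpace ℝ (Fin n)) (i j : Fin n) :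
    metricMatrix g e y i j = metricMatrix g e y j i :=
  g.symm _ _ _

/-- The metric matrix lowers the index of the coordinates of a tangent vector. -/
theorem metricMatrix_mulVec (he : e ∈ atlas (EuclideanSpace ℝ (Fin n)) M)
    {y : EuclideanSpace ℝ (Fin n)} (hy : y ∈ e.target) (w : TangentSpace (𝓡 n) (e.symm y))
    (i : Fin n) : (metricMatrix g e y *ᵥ (coordBasis he hy).repr w) i
      = g.inner (e.symm y) w (coordVec e i y) := by
  conv_rhs => rw [← (coordBasis he hy).sum_repr w]
  rw [g.symm]
  simp only [map_sum, map_smul, coordBasis_apply, Matrix.mulVec, dotProduct, smul_eq_mul,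
    metricMatrix, Matrix.of_apply]
  exact Finset.sum_congr rfl fun _ _ ↦ mul_comm _ _

theorem inner_self_eq (he : e ∈ atlas (EuclideanSpace ℝ (Fin n)) M)
    {y : EuclideanSpace ℝ (Fin n)} (hy : y ∈ e.target) (w : TangentSpace (𝓡 n) (e.symm y)) :
    g.inner (e.symm y) w w
      = ∑ k, (coordBasis he hy).repr w k * g.inner (e.symm y) w (coordVec e k y) := by
  have h := congrArg (g.inner (e.symm y) w) ((coordBasis he hy).sum_repr w)
  simp only [map_sum, map_smul, coordBasis_apply, smul_eq_mul] at h
  exact h.symm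

theorem det_metricMatrix_ne_zero (he : e ∈ atlas (EuclideanSpace ℝ (Fin n)) M)
    {y : EuclideanSpace ℝ (Fin n)} (hy : y ∈ e.target) : (metricMatrix g e y).det ≠ 0 := by
  intro h0
  obtain ⟨v, hv, hGv⟩ := Matrix.exists_mulVec_eq_zero_iff.2 h0
  set w := (coordBasis he hy).equivFun.symm v with hw
  have hrepr : ((coordBasis he hy).repr w : Fin n → ℝ) = v :=
    (coordBasis he hy).equivFun.apply_symm_apply v
  have hw0 : w ≠ 0 := fun h ↦ hv (by rw [← hrepr, h]; simp)
  refine (g.pos _ w hw0).ne' ?_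
  rw [inner_self_eq g he hy]
  refine Finset.sum_eq_zero fun k _ ↦ ?_
  rw [← metricMatrix_mulVec g he hy, hrepr, hGv, Pi.zero_apply, mul_zero]

theorem pd_comp_symm (he : e ∈ atlas (EuclideanSpace ℝ (Fin n)) M)
    {y : EuclideanSpace ℝ (Fin n)} (hy : y ∈ e.target) {u : M → ℝ}
    (hu : MDifferentiableAt (𝓡 n) 𝓘(ℝ) u (e.symm y)) (i : Fin n) :
    pd i (u ∘ e.symm) y = mvfderiv (𝓡 n) u (e.symm y) (coordVec e i y) := by
  have h := mvfderiv_comp_apply y hu ((mdifferentiable_chart he).mdifferentiableAt_symm hy)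
    (EuclideanSpace.single i (1 : ℝ) : EuclideanSpace ℝ (Fin n))
  rw [coordVec, ← h, pd, mvfderiv, mfderiv_eq_fderiv]
  rfl

/-- In a chart, `‖∇u‖² = h^{ka} ∂_k u ∂_a u`. -/
theorem gradNormSq_eq (he : e ∈ atlas (EuclideanSpace ℝ (Fin n)) M)
    {y : EuclideanSpace ℝ (Fin n)} (hy : y ∈ e.target) {u : M → ℝ}
    (hu : MDifferentiableAt (𝓡 n) 𝓘(ℝ) u (e.symm y)) :
    gradNormSq g u (e.symm y) = coordNormSqGrad (metricMatrix g e) (u ∘ e.symm) y := by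
  have hgrad (k) : g.inner (e.symm y) (gradient g u (e.symm y)) (coordVec e k y)
      = pd k (u ∘ e.symm) y := by
    rw [pd_comp_symm he hy hu]
    exact Classical.choose_spec (exists_gradient g u (e.symm y)) _
  have hrepr : ((coordBasis he hy).repr (gradient g u (e.symm y)) : Fin n → ℝ)
      = (metricMatrix g e y)⁻¹ *ᵥ fun a ↦ pd a (u ∘ e.symm) y := by
    have : (fun a ↦ pd a (u ∘ e.symm) y)
        = metricMatrix g e y *ᵥ (coordBasis he hy).repr (gradient g u (e.symm y)) := by
      funext a
      rw [metricMatrix_mulVec, hgrad]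
    rw [this, Matrix.mulVec_mulVec,
      Matrix.nonsing_inv_mul _ (det_metricMatrix_ne_zero g he hy).isUnit, Matrix.one_mulVec]
  rw [gradNormSq, inner_self_eq g he hy, coordNormSqGrad]
  refine Finset.sum_congr rfl fun k _ ↦ ?_
  rw [hgrad, hrepr, mul_comm]
  rfl

theorem wedge₃_eq_zero_of_basis {V ι : Type*} [AddCommGroup V] [Module ℝ V]
    (b : Module.Basis ι ℝ V) (α β γ : V →ₗ[ℝ] ℝ)
    (h : ∀ i j k, α (b i) * (β (b j) * γ (b k) - β (b k) * γ (b j))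
      - α (b j) * (β (b i) * γ (b k) - β (b k) * γ (b i))
      + α (b k) * (β (b i) * γ (b j) - β (b j) * γ (b i)) = 0) :
    wedge₃ α β γ = 0 := by
  refine b.ext_alternating fun v _ ↦ ?_
  change Matrix.det (.of fun i ↦ LinearMap.pi ![α, β, γ] (b (v i))) = 0
  rw [Matrix.det_fin_three]
  simp only [Matrix.of_apply, LinearMap.pi_apply, Matrix.cons_val]
  linear_combination h (v 0) (v 1) (v 2)

end Manifold

end QuasiEinstein

theorem proposition2p1 {n : ℕ} (hn : 3 ≤ n) {M : Type*} [TopologicalSpace M] [T2Space M]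
    [SecondCountableTopology M] [ConnectedSpace M] [ChartedSpace (EuclideanSpace ℝ (Fin n)) M]
    [IsManifold (𝓡 n) ∞ M]
    (g : Bundle.ContMDiffRiemannianMetric (𝓡 n) ∞ (EuclideanSpace ℝ (Fin n))
      (fun x : M ↦ TangentSpace (𝓡 n) x))
    (f lam ν : M → ℝ) (h : QuasiEinstein.IsGeneralizedQuasiEinstein g f lam ν) :
    ∀ p : M, QuasiEinstein.wedge₃
      (mvfderiv (𝓡 n) (QuasiEinstein.gradNormSq g f) p).toLinearMap
      (mvfderiv (𝓡 n) ν p).toLinearMap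
      (mvfderiv (𝓡 n) f p).toLinearMap = 0 := by
  open QuasiEinstein in
  intro p
  obtain ⟨e, he, hp⟩ : ∃ e ∈ atlas (EuclideanSpace ℝ (Fin n)) M, p ∈ e.source :=
    ⟨_, chart_mem_atlas _ p, mem_chart_source _ p⟩
  obtain ⟨y, hy, rfl⟩ : ∃ y ∈ e.target, e.symm y = p := ⟨e p, e.map_source hp, e.left_inv hp⟩
  let U : TopologicalSpace.Opens (EuclideanSpace ℝ (Fin n)) := ⟨e.target, e.open_target⟩
  have hsmooth {u : M → ℝ} (hu : ContMDiff (𝓡 n) 𝓘(ℝ) ∞ u) : ContDiffOn ℝ ∞ (u ∘ e.symm) U :=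
    contMDiffOn_iff_contDiffOn.1 (hu.comp_contMDiffOn (contMDiffOn_chart_symm he))
  have hdiff {u : M → ℝ} (hu : ContMDiff (𝓡 n) 𝓘(ℝ) ∞ u) : MDifferentiable (𝓡 n) 𝓘(ℝ) u :=
    hu.mdifferentiable (by simp)
  have hS (z : EuclideanSpace ℝ (Fin n)) (hz : z ∈ e.target) :
      gradNormSq g f (e.symm z) = coordNormSqGrad (metricMatrix g e) (f ∘ e.symm) z :=
    gradNormSq_eq g he hz (hdiff h.smooth_f _)
  have hdet (z) (hz : z ∈ U) := det_metricMatrix_ne_zero g he hz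
  -- without differentiability, `mvfderiv` would take a junk value unrelated to the partial derivatives
  have hSd : MDifferentiableAt (𝓡 n) 𝓘(ℝ) (gradNormSq g f) (e.symm y) := by
    have h1 : MDifferentiableAt (𝓡 n) 𝓘(ℝ)
        (coordNormSqGrad (metricMatrix g e) (f ∘ e.symm) ∘ e) (e.symm y) := by
      have h2 := differentiableAt_of_mem (contDiffOn_coordNormSqGrad
        (contDiffOn_metricMatrix g he) hdet (hsmooth h.smooth_f)) (⟨y, hy⟩ : U)
      refine MDifferentiableAt.comp (I' := 𝓡 n) (e.symm y) ?_
        ((mdifferentiable_chart he).mdifferentiableAt (e.map_target hy))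
      rw [e.right_inv hy]
      exact h2.mdifferentiableAt
    refine h1.congr_of_eventuallyEq ?_
    filter_upwards [e.open_source.mem_nhds (e.map_target hy)] with q hq
    rw [Function.comp_apply, ← hS _ (e.map_source hq), e.left_inv hq]
  refine wedge₃_eq_zero_of_basis (coordBasis he hy) _ _ _ fun i j k ↦ ?_
  have key := coord_wedge_eq_zero (U := U) (contDiffOn_metricMatrix g he) hdet
    (fun z _ ↦ metricMatrix_symm g z) (hsmooth h.smooth_f) (hsmooth h.smooth_lam)
    (hsmooth h.smooth_ν) (h.equation e he) hy i j k
  have hpd (a) : pd a (coordNormSqGrad (metricMatrix g e) (f ∘ e.symm)) y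
      = mvfderiv (𝓡 n) (gradNormSq g f) (e.symm y) (coordVec e a y) := by
    rw [← pd_comp_symm he hy hSd]
    exact pd_congr (U := U) (fun z ↦ (hS z z.2).symm) a ⟨y, hy⟩
  simp only [hpd, pd_comp_symm he hy (hdiff h.smooth_f _),
    pd_comp_symm he hy (hdiff h.smooth_ν _)] at key
  simp only [coordBasis_apply]
  exact key

end
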